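/- Let $a_1,\dots,a_n$ be nonzero integers and let $D$ be the standard diagram of the rational link encoded by the continued fraction $[0,a_1,\dots,a_n]$, with any orientation of the link. That is, $D$ is the following 4-plat diagram. Its four strands are numbered $1,2,3,4$ from top to bottom and run horizontally. At the left end strands $1,2$ are joined and strands $3,4$ are joined. From left to right there follow $n$ twist boxes, the $k$-th one consisting of $|a_k|$ crossings of strands $2,3$ if $k$ is odd and of strands $1,2$ if $k$ is even. At the right end $\{1,2\}$ and $\{3,4\}$ are joined if $n$ is odd, and $\{1,4\}$ and $\{2,3\}$ if $n$ is even. Put $m_k=(-1)^{k-1}a_k$; in the $k$-th box the overstrand of each crossing runs from lower left to upper right if $m_k>0$, and from upper left to lower right if $m_k<0$. Let $\langle D\rangle\in\mathbb Z[A,A^{-1}]$ be the Kauffman bracket of $D$ (equal to $1$ on a circle without crossings), $w(D)$ the writhe, and $V(t)=(-A^{-3})^{w(D)}\langle D\rangle$, with $A=t^{-1/4}$, the Jones polynomial. Put $d=-A^2-A^{-2}$ and $u=iA^2$, and define the Lawrence–Rosenstein polynomial of $D$ by $$R_D(t)=u^{\sum_{k=1}^n m_k}\cdot\frac{d^{\,n}\,V(t)}{(-A)^{-3w(D)+3\sum_{k=1}^n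 m_k}}\in\mathbb C[A,A^{-1}].$$ Then $$R_D(t)=\begin{bmatrix}1&0\end{bmatrix}\begin{bmatrix}u^{m_n}-u^{-m_n}&u^{-m_n}d\\u^{m_n}d&0\end{bmatrix}\cdots\begin{bmatrix}u^{m_1}-u^{-m_1}&u^{-m_1}d\\u^{m_1}d&0\end{bmatrix}\begin{bmatrix}1\\d\end{bmatrix}$$ and $$R_D(t)=\sum_{S\subseteq\{1,\dots,n\}}\Bigl(\prod_{k\notin S}u^{m_k}\Bigr)\Bigl(\prod_{k\in S}(-u^{-m_k})\Bigr)(u^2+u^{-2}-1)^{|I(S)|},$$ where $I(S)$ is the set of intervals of $S$, that is, of the maximal subsets of $S$ of the form $\{k,k+1,\dots,\ell\}$ with $k\le\ell$. -/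

import Mathlib

open scoped LaurentPolynomial

noncomputable section

/-! ## Four-strand plat diagrams

Four strands, numbered from top to bottom by `0, 1, 2, 3 : Fin 4`, run horizontally.  Between
consecutive levels `0, 1, …, size` there is exactly one crossing, of two neighbouring strands.
At each end the four strands are joined in pairs. -/

/-- How the overcrossing strand of a crossing runs, read from left to right. -/
inductive Overstrand where
  /-- from the lower left to the upper right -/
  | rising
  /-- from the upper left to the lower right -/
  | falling
  deriving DecidableEq

/-- A crossing of strands `upper` and `upper + 1`. -/
structure PlatCrossing where
  upper : Fin 3
  overstrand : Overstrand

/-- The strand position immediately above the crossing (before or after it). -/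
def PlatCrossing.top (c : PlatCrossing) : Fin 4 := c.upper.castSucc

/-- The strand position immediately below the crossing (before or after it). -/
def PlatCrossing.bot (c : PlatCrossing) : Fin 4 := c.upper.succ

/-- The planar ways of joining the four strands at an end of the diagram. -/
inductive PlatClosing where
  /-- first with second, third with fourth -/
  | adjacent
  /-- first with fourth, second with third -/
  | nested
  deriving DecidableEq

/-- The strand position with which a position is joined. -/
def PlatClosing.mate : PlatClosing → Fin 4 → Fin 4
  | .adjacent => ![1, 0, 3, 2]
  | .nested => ![3, 2, 1, 0]

/-- An unoriented 4-plat diagram.  The left ends are always joined first with second and third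
with fourth; `closing` says how the right ends are joined. -/
structure FourPlat where
  size : ℕ
  crossing : Fin size → PlatCrossing
  closing : PlatClosing

namespace FourPlat

/-- The points at which the strands meet the levels. -/
abbrev Point (D : FourPlat) : Type := Fin (D.size + 1) × Fin 4

/-! ### The Kauffman bracket -/

/-- The two smoothings of a crossing. `A` merges the two regions swept out when the overstrand is
turned counterclockwise until it meets the understrand; `B` merges the other two. -/
inductive Smoothing where
  | A
  | B
  deriving DecidableEq

instance : Fintype Smoothing where
  elems := {.A, .B}
  complete := by rintro (_ | _) <;> simp

/-- Whether a smoothing merges the regions above and below the crossing, so that the two left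
ends get joined with each other, and the two right ends with each other.  Otherwise it merges the
regions to the left and to the right, so that both strands run through horizontally. -/
def Smoothing.IsVertical : Smoothing → Overstrand → Prop
  | .A, o => o = .rising
  | .B, o => o = .falling

/-- Two points are joined by an elementary arc of the diagram smoothed according to `s`. -/
inductive Joined (D : FourPlat) (s : Fin D.size → Smoothing) : D.Point → D.Point → Prop
  | leftEnd (i : Fin 4) : Joined D s (0, i) (0, PlatClosing.adjacent.mate i)
  | rightEnd (i : Fin 4) :
      Joined D s (Fin.last D.size, i) (Fin.last D.size, D.closing.mate i)
  | away (j : Fin D.size) (i : Fin 4) (ht : i ≠ (D.crossing j).top)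
      (hb : i ≠ (D.crossing j).bot) : Joined D s (j.castSucc, i) (j.succ, i)
  | horizontal (j : Fin D.size) (i : Fin 4) (h : ¬ (s j).IsVertical (D.crossing j).overstrand) :
      Joined D s (j.castSucc, i) (j.succ, i)
  | verticalLeft (j : Fin D.size) (h : (s j).IsVertical (D.crossing j).overstrand) :
      Joined D s (j.castSucc, (D.crossing j).top) (j.castSucc, (D.crossing j).bot)
  | verticalRight (j : Fin D.size) (h : (s j).IsVertical (D.crossing j).overstrand) :
      Joined D s (j.succ, (D.crossing j).top) (j.succ, (D.crossing j).bot)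

/-- The number of closed curves of the diagram smoothed according to `s`: the number of classes
of points under the equivalence relation generated by `Joined`. -/
def loops (D : FourPlat) (s : Fin D.size → Smoothing) : ℕ := Nat.card (Quot (D.Joined s))

end FourPlat

/-- The variable `A` of the ring `ℂ[A, A⁻¹]` of Laurent polynomials, as a unit.  The variable of
the Jones polynomial is `t = A⁻⁴`, that is, `A = t^(-1/4)`. -/
def kauffmanA : (ℂ[T;T⁻¹])ˣ where
  val := LaurentPolynomial.T 1
  inv := LaurentPolynomial.T (-1)
  val_inv := by rw [← LaurentPolynomial.T_add]; simp
  inv_val := by rw [← LaurentPolynomial.T_add]; simp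

/-- `d = -A² - A⁻²`. -/
def loopValue : ℂ[T;T⁻¹] := -((kauffmanA ^ 2 : (ℂ[T;T⁻¹])ˣ) : ℂ[T;T⁻¹])
  - ((kauffmanA ^ (-2 : ℤ) : (ℂ[T;T⁻¹])ˣ) : ℂ[T;T⁻¹])

namespace FourPlat

/-- The factor `A` or `A⁻¹` of a smoothing. -/
def Smoothing.weight : Smoothing → (ℂ[T;T⁻¹])ˣ
  | .A => kauffmanA
  | .B => kauffmanA⁻¹

/-- The Kauffman bracket, normalized to be `1` on a circle without crossings (the number of loops
is always positive). -/
def bracket (D : FourPlat) : ℂ[T;T⁻¹] :=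
  ∑ s : Fin D.size → Smoothing,
    ((∏ j, (s j).weight : (ℂ[T;T⁻¹])ˣ) : ℂ[T;T⁻¹]) * loopValue ^ (D.loops s - 1)

/-! ### Orientations, writhe and the Jones polynomial -/

/-- An orientation of all components: `toRight` says whether the strand through a point is
traversed from left to right there. -/
structure Orientation (D : FourPlat) where
  toRight : D.Point → Bool
  leftEnd : ∀ i, toRight (0, PlatClosing.adjacent.mate i) = !toRight (0, i)
  rightEnd : ∀ i, toRight (Fin.last D.size, D.closing.mate i) = !toRight (Fin.last D.size, i)
  along : ∀ (j : Fin D.size) (i : Fin 4),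
    toRight (j.succ, Equiv.swap (D.crossing j).top (D.crossing j).bot i) =
      toRight (j.castSucc, i)

/-- The sign of a crossing of an oriented diagram: positive if turning the overstrand
counterclockwise by less than a half-turn takes its direction to that of the understrand. -/
def crossingSign (D : FourPlat) (o : D.Orientation) (j : Fin D.size) : ℤ :=
  match (D.crossing j).overstrand,
    o.toRight (j.castSucc, (D.crossing j).top) == o.toRight (j.castSucc, (D.crossing j).bot) with
  | .rising, true => -1
  | .rising, false => 1
  | .falling, true => 1
  | .falling, false => -1

/-- The writhe. -/
def writhe (D : FourPlat) (o : D.Orientation) : ℤ := ∑ j, D.crossingSign o j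

/-- The Jones polynomial `(-A⁻³)^w ⟨D⟩` of the oriented link with diagram `D`, where `t = A⁻⁴`. -/
def jones (D : FourPlat) (o : D.Orientation) : ℂ[T;T⁻¹] :=
  (((-kauffmanA ^ (-3 : ℤ)) ^ D.writhe o : (ℂ[T;T⁻¹])ˣ) : ℂ[T;T⁻¹]) * D.bracket

end FourPlat

/-! ## Standard diagrams of rational links

The numbers `a₁, …, aₙ` are given as `a : Fin n → ℤ`, so that `a k` is the entry number `k + 1`. -/

/-- `mₖ = (-1)^(k-1) aₖ`, whose sign is the twist sign of the `k`-th twist box. -/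
def twistNumber {n : ℕ} (a : Fin n → ℤ) (k : Fin n) : ℤ := (-1) ^ (k : ℕ) * a k

/-- The crossings in a twist box: they involve the second and third strand in the first, third,
fifth, … box and the first and second strand in the second, fourth, … box. -/
def twistCrossing {n : ℕ} (a : Fin n → ℤ) (k : Fin n) : PlatCrossing where
  upper := if Even (k : ℕ) then 1 else 0
  overstrand := if 0 < twistNumber a k then .rising else .falling

/-- All crossings, from left to right: `|aₖ|` crossings in the `k`-th twist box. -/
def rationalWord {n : ℕ} (a : Fin n → ℤ) : List PlatCrossing :=
  (List.ofFn fun k => List.replicate (a k).natAbs (twistCrossing a k)).flatten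

/-- The standard diagram of the rational link encoded by `[0, a₁, …, aₙ]`. -/
def rationalDiagram {n : ℕ} (a : Fin n → ℤ) : FourPlat where
  size := (rationalWord a).length
  crossing := (rationalWord a).get
  closing := if Even n then .nested else .adjacent

/-! ## The Lawrence–Rosenstein polynomial -/

/-- `u = i A²`, a square root of `-t⁻¹`. -/
def lrU : (ℂ[T;T⁻¹])ˣ :=
  Units.map (LaurentPolynomial.C : ℂ →+* ℂ[T;T⁻¹]).toMonoidHom
    (Units.mk0 Complex.I Complex.I_ne_zero) * kauffmanA ^ 2

/-- `u ^ m` as a Laurent polynomial, for an integer `m`. -/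
def lrPow (m : ℤ) : ℂ[T;T⁻¹] := ((lrU ^ m : (ℂ[T;T⁻¹])ˣ) : ℂ[T;T⁻¹])

/-- The Lawrence–Rosenstein polynomial
`u^(∑ mₖ) dⁿ V(t) / (-A)^(-3 w + 3 ∑ mₖ)` of the standard diagram encoded by `[0, a₁, …, aₙ]`
with the orientation `o`. -/
def lawrenceRosenstein {n : ℕ} (a : Fin n → ℤ) (o : (rationalDiagram a).Orientation) :
    ℂ[T;T⁻¹] :=
  lrPow (∑ k, twistNumber a k) * (loopValue ^ n * (rationalDiagram a).jones o) *
    ((((-kauffmanA) ^ (-3 * (rationalDiagram a).writhe o + 3 * ∑ k, twistNumber a k))⁻¹ :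
      (ℂ[T;T⁻¹])ˣ) : ℂ[T;T⁻¹])

/-- The matrix factor of a twist box. -/
def lrMatrix (m : ℤ) : Matrix (Fin 2) (Fin 2) ℂ[T;T⁻¹] :=
  !![lrPow m - lrPow (-m), lrPow (-m) * loopValue;
     lrPow m * loopValue, 0]

/-- The set `I(S)` of intervals of `S`: the maximal subsets of `S` of the form
`{k, k + 1, …, l}` with `k ≤ l`. -/
def maxIntervals {n : ℕ} (S : Finset (Fin n)) : Set (Finset (Fin n)) :=
  {J | Maximal (fun J' => J' ⊆ S ∧ ∃ k l : Fin n, k ≤ l ∧ J' = Finset.Icc k l) J}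

end

/-! The idea is to follow the pair of brackets belonging to the two right closings. Smoothing the
last crossing horizontally deletes it. Smoothing it vertically closes the rest of the diagram by
`innerClosing`, with one extra circle exactly when the right closing already was that one
(`loops_of_not_isVertical`, `loops_of_isVertical_of_ne`, `loops_of_isVertical_of_eq`). Hence a
crossing acts linearly on the pair, as a combination of the identity and an operator E = `cupCap`
with E² = dE.

In R_D the writhe cancels, and each crossing of a box is rescaled by κ = u(-A)⁻³ or by κ⁻¹,
according to its twist sign. A rescaled rising crossing is u⁻¹ - iE, where -id = u - u⁻¹; it
therefore acts as u on the image of E. A falling one is u + iE, with u and u⁻¹ exchanged. Both signs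
give the same formula for a box: d times its action is u⁻ᵐ d + (uᵐ - u⁻ᵐ)E. The factor dⁿ in R_D
clears these denominators.

Let x, y be the rescaled brackets with the standard and with the other closing. The closing attached
to E in the next box is the current standard one, so the box sends (x, y) to ((uᵐ - u⁻ᵐ)x + u⁻ᵐdy,
uᵐdx), which is the matrix product. In the expansion, y is d times the part of the sum for x over
sets S without the last index. A new index either prolongs the last interval of S or, if the
previous index is missing, starts a new one and contributes 1 - d² = u² + u⁻² - 1. -/

noncomputable section

namespace FourPlat

/-- The closing seen from the left of a crossing smoothed vertically. -/
def innerClosing (u : Fin 3) : PlatClosing := if u = 1 then .nested else .adjacent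

/-! ### Loop counts when the last crossing is removed -/

section Loops

variable {m : ℕ} {f : Fin (m + 1) → PlatCrossing} {X Y : PlatClosing}
  {s : Fin (m + 1) → Smoothing}

/-- An elementary arc left of the last crossing persists in the longer diagram. -/
theorem Joined.castSucc {a b : Point ⟨m, f ∘ Fin.castSucc, Y⟩}
    (h : Joined ⟨m, f ∘ Fin.castSucc, Y⟩ (s ∘ Fin.castSucc) a b) :
    Joined ⟨m + 1, f, X⟩ s (a.1.castSucc, a.2) (b.1.castSucc, b.2) ∨
      ∃ i, a = (Fin.last m, i) ∧ b = (Fin.last m, Y.mate i) := by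
  cases h with
  | leftEnd i => exact .inl (.leftEnd (D := ⟨m + 1, f, X⟩) i)
  | rightEnd i => exact .inr ⟨i, rfl, rfl⟩
  | away j i ht hb => exact .inl (.away (D := ⟨m + 1, f, X⟩) j.castSucc i ht hb)
  | horizontal j i h => exact .inl (.horizontal (D := ⟨m + 1, f, X⟩) j.castSucc i h)
  | verticalLeft j h => exact .inl (.verticalLeft (D := ⟨m + 1, f, X⟩) j.castSucc h)
  | verticalRight j h => exact .inl (.verticalRight (D := ⟨m + 1, f, X⟩) j.castSucc h)

/-- To respect all elementary arcs, it is enough to respect those left of the last crossing,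
those at the last crossing, and those at the right end. -/
theorem Joined.lift_succ {Q : Type*} (g : Fin (m + 1) × Fin 4 → Q) (t : Fin 4 → Q)
    (hg : ∀ a b, Joined ⟨m, f ∘ Fin.castSucc, Y⟩ (s ∘ Fin.castSucc) a b → g a = g b)
    (hX : ∀ i, t i = t (X.mate i))
    (haway : ∀ i, i ≠ (f (Fin.last m)).top → i ≠ (f (Fin.last m)).bot →
      g (Fin.last m, i) = t i)
    (hhor : ¬ (s (Fin.last m)).IsVertical (f (Fin.last m)).overstrand →
      ∀ i, g (Fin.last m, i) = t i)
    (hver : (s (Fin.last m)).IsVertical (f (Fin.last m)).overstrand →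
      g (Fin.last m, (f (Fin.last m)).top) = g (Fin.last m, (f (Fin.last m)).bot) ∧
        t (f (Fin.last m)).top = t (f (Fin.last m)).bot)
    {x y : Point ⟨m + 1, f, X⟩} (h : Joined ⟨m + 1, f, X⟩ s x y) :
    Fin.lastCases (motive := fun _ => Q) (t x.2) (fun j => g (j, x.2)) x.1 =
      Fin.lastCases (motive := fun _ => Q) (t y.2) (fun j => g (j, y.2)) y.1 := by
  cases h with
  | leftEnd i =>
    change Fin.lastCases (motive := fun _ => Q) (t i) _ (Fin.castSucc 0) =
      Fin.lastCases (motive := fun _ => Q) (t (PlatClosing.adjacent.mate i)) _ (Fin.castSucc 0)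
    simp only [Fin.lastCases_castSucc]
    exact hg _ _ (.leftEnd (D := ⟨m, f ∘ Fin.castSucc, Y⟩) i)
  | rightEnd i => simpa using hX i
  | away j i ht hb =>
    induction j using Fin.lastCases with
    | last => simpa using haway i ht hb
    | cast j =>
      simp only [Fin.succ_castSucc, Fin.lastCases_castSucc]
      exact hg _ _ (.away (D := ⟨m, f ∘ Fin.castSucc, Y⟩) j i ht hb)
  | horizontal j i h =>
    induction j using Fin.lastCases with
    | last => simpa using hhor h i
    | cast j =>
      simp only [Fin.succ_castSucc, Fin.lastCases_castSucc]
      exact hg _ _ (.horizontal (D := ⟨m, f ∘ Fin.castSucc, Y⟩) j i h)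
  | verticalLeft j h =>
    induction j using Fin.lastCases with
    | last => simpa using (hver h).1
    | cast j =>
      simp only [Fin.lastCases_castSucc]
      exact hg _ _ (.verticalLeft (D := ⟨m, f ∘ Fin.castSucc, Y⟩) j h)
  | verticalRight j h =>
    induction j using Fin.lastCases with
    | last => simpa using (hver h).2
    | cast j =>
      simp only [Fin.succ_castSucc, Fin.lastCases_castSucc]
      exact hg _ _ (.verticalRight (D := ⟨m, f ∘ Fin.castSucc, Y⟩) j h)

/-- Removing the last crossing, where the points right of it lie on curves that
continue to its left. -/
def quotEquivOfRight (τ : Fin 4 → Fin 4)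
    (hτ : ∀ i, Quot.mk (Joined ⟨m + 1, f, X⟩ s) (Fin.last (m + 1), i) =
      Quot.mk _ ((Fin.last m).castSucc, τ i))
    (hY : ∀ i, Quot.mk (Joined ⟨m + 1, f, X⟩ s) ((Fin.last m).castSucc, i) =
      Quot.mk _ ((Fin.last m).castSucc, Y.mate i))
    (hlift : ∀ x y : Fin (m + 2) × Fin 4, Joined ⟨m + 1, f, X⟩ s x y →
      Fin.lastCases (motive := fun _ => Quot (Joined ⟨m, f ∘ Fin.castSucc, Y⟩ (s ∘ Fin.castSucc)))
        (Quot.mk _ (Fin.last m, τ x.2)) (fun j => Quot.mk _ (j, x.2)) x.1 =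
      Fin.lastCases (motive := fun _ => Quot (Joined ⟨m, f ∘ Fin.castSucc, Y⟩ (s ∘ Fin.castSucc)))
        (Quot.mk _ (Fin.last m, τ y.2)) (fun j => Quot.mk _ (j, y.2)) y.1) :
    Quot (Joined ⟨m + 1, f, X⟩ s) ≃
      Quot (Joined ⟨m, f ∘ Fin.castSucc, Y⟩ (s ∘ Fin.castSucc)) where
  toFun := Quot.lift _ hlift
  invFun := Quot.lift (fun a : Fin (m + 1) × Fin 4 => Quot.mk _ (a.1.castSucc, a.2)) (by
    intro a b h
    obtain h | ⟨i, rfl, rfl⟩ := h.castSucc (X := X)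
    · exact Quot.sound h
    · exact hY i)
  left_inv := by
    rintro ⟨j, i⟩
    induction j using Fin.lastCases with
    | last => simpa using (hτ i).symm
    | cast j => simp
  right_inv := by
    rintro ⟨j, i⟩
    simp

/-- Removing the last crossing, where some points right of it make up one closed curve. -/
def quotEquivOption (c : Fin 4 → Bool) (i₀ : Fin 4) (hi₀ : c i₀ = true)
    (hc : ∀ i, c i = true → Quot.mk (Joined ⟨m + 1, f, X⟩ s) (Fin.last (m + 1), i) =
      Quot.mk _ (Fin.last (m + 1), i₀))
    (hτ : ∀ i, c i = false → Quot.mk (Joined ⟨m + 1, f, X⟩ s) (Fin.last (m + 1), i) =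
      Quot.mk _ ((Fin.last m).castSucc, i))
    (hY : ∀ i, Quot.mk (Joined ⟨m + 1, f, X⟩ s) ((Fin.last m).castSucc, i) =
      Quot.mk _ ((Fin.last m).castSucc, Y.mate i))
    (hlift : ∀ x y : Fin (m + 2) × Fin 4, Joined ⟨m + 1, f, X⟩ s x y →
      Fin.lastCases
        (motive := fun _ => Option (Quot (Joined ⟨m, f ∘ Fin.castSucc, Y⟩ (s ∘ Fin.castSucc))))
        (if c x.2 then none else some (Quot.mk _ (Fin.last m, x.2)))
        (fun j => some (Quot.mk _ (j, x.2))) x.1 =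
      Fin.lastCases
        (motive := fun _ => Option (Quot (Joined ⟨m, f ∘ Fin.castSucc, Y⟩ (s ∘ Fin.castSucc))))
        (if c y.2 then none else some (Quot.mk _ (Fin.last m, y.2)))
        (fun j => some (Quot.mk _ (j, y.2))) y.1) :
    Quot (Joined ⟨m + 1, f, X⟩ s) ≃
      Option (Quot (Joined ⟨m, f ∘ Fin.castSucc, Y⟩ (s ∘ Fin.castSucc))) where
  toFun := Quot.lift _ hlift
  invFun o := o.elim (Quot.mk _ (Fin.last (m + 1), i₀))
    (Quot.lift (fun a : Fin (m + 1) × Fin 4 => Quot.mk _ (a.1.castSucc, a.2)) (by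
      intro a b h
      obtain h | ⟨i, rfl, rfl⟩ := h.castSucc (X := X)
      · exact Quot.sound h
      · exact hY i))
  left_inv := by
    rintro ⟨j, i⟩
    induction j using Fin.lastCases with
    | last =>
      cases h : c i
      · simpa [h] using (hτ i h).symm
      · simpa [h] using (hc i h).symm
    | cast j => simp
  right_inv := by
    rintro (_ | ⟨j, i⟩)
    · simp [hi₀]
    · simp

theorem mk_right_mate (i : Fin 4) :
    Quot.mk (Joined ⟨m + 1, f, X⟩ s) (Fin.last (m + 1), i) =
      Quot.mk _ (Fin.last (m + 1), X.mate i) :=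
  Quot.sound (.rightEnd (D := ⟨m + 1, f, X⟩) i)

theorem mk_away (i : Fin 4) (ht : i ≠ (f (Fin.last m)).top) (hb : i ≠ (f (Fin.last m)).bot) :
    Quot.mk (Joined ⟨m + 1, f, X⟩ s) ((Fin.last m).castSucc, i) =
      Quot.mk _ (Fin.last (m + 1), i) :=
  Quot.sound (.away (D := ⟨m + 1, f, X⟩) (Fin.last m) i ht hb)

theorem loops_of_not_isVertical
    (h : ¬ (s (Fin.last m)).IsVertical (f (Fin.last m)).overstrand) :
    loops ⟨m + 1, f, X⟩ s = loops ⟨m, f ∘ Fin.castSucc, X⟩ (s ∘ Fin.castSucc) := by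
  have key (i : Fin 4) : Quot.mk (Joined ⟨m + 1, f, X⟩ s) ((Fin.last m).castSucc, i) =
      Quot.mk _ (Fin.last (m + 1), i) :=
    Quot.sound (.horizontal (D := ⟨m + 1, f, X⟩) (Fin.last m) i h)
  refine Nat.card_congr (quotEquivOfRight id (fun i => (key i).symm) (fun i => ?_) ?_)
  · rw [key, key, ← mk_right_mate]
  · intro x y hxy
    exact Joined.lift_succ (Y := X) (Quot.mk _) (fun i => Quot.mk _ (Fin.last m, i))
      (fun _ _ h => Quot.sound h)
      (fun i => Quot.sound (.rightEnd (D := ⟨m, f ∘ Fin.castSucc, X⟩) i))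
      (fun _ _ _ => rfl) (fun _ _ => rfl) (fun h' => absurd h' h) hxy

/-- The left arc of the smoothing joins two of the points. The other two strands pass the crossing
and meet on its right, either directly through the closing or through closing, right arc and closing
again. -/
theorem mk_innerClosing (h : (s (Fin.last m)).IsVertical (f (Fin.last m)).overstrand) (i : Fin 4) :
    Quot.mk (Joined ⟨m + 1, f, X⟩ s) ((Fin.last m).castSucc, i) =
      Quot.mk _ ((Fin.last m).castSucc, (innerClosing (f (Fin.last m)).upper).mate i) := by
  have hX := mk_right_mate (f := f) (X := X) (s := s)
  have ha := mk_away (f := f) (X := X) (s := s)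
  have hl : Quot.mk (Joined ⟨m + 1, f, X⟩ s) _ = Quot.mk _ _ :=
    Quot.sound (.verticalLeft (D := ⟨m + 1, f, X⟩) (Fin.last m) h)
  have hr : Quot.mk (Joined ⟨m + 1, f, X⟩ s) _ = Quot.mk _ _ :=
    Quot.sound (.verticalRight (D := ⟨m + 1, f, X⟩) (Fin.last m) h)
  dsimp only [PlatCrossing.top, PlatCrossing.bot] at ha hl hr ⊢
  generalize (f (Fin.last m)).upper = u at *
  simp only [Fin.succ_last] at hr
  -- Only the classes of the four points on either side of the crossing matter; abstracting them
  -- leaves a finite check.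
  generalize hp : (fun i => Quot.mk (Joined ⟨m + 1, f, X⟩ s) ((Fin.last m).castSucc, i)) = p at *
  generalize hq : (fun i => Quot.mk (Joined ⟨m + 1, f, X⟩ s) (Fin.last (m + 1), i)) = q at *
  simp only [funext_iff] at hp hq
  simp only [hp, hq] at *
  clear hp hq
  have h0 := hX 0
  have h1 := hX 1
  have h2 := hX 2
  have h3 := hX 3
  have a0 := ha 0
  have a1 := ha 1
  have a2 := ha 2
  have a3 := ha 3
  clear hX ha
  cases X <;> fin_cases u <;> fin_cases i <;>
    simp_all [PlatClosing.mate, innerClosing]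

/-- Since `X` is the other closing, it leads the two right ends of the crossing to the two strands
away from it, and these are mates under `innerClosing u`. This gives the compatibilities required by
`Joined.lift_succ`. -/
theorem reroute_eq {Q : Type*} {X : PlatClosing} {u : Fin 3} (hX : X ≠ innerClosing u)
    (p : Fin 4 → Q) (hp : ∀ i, p i = p ((innerClosing u).mate i)) :
    (∀ i, p (if i = u.castSucc ∨ i = u.succ then X.mate i else i) =
      p (if X.mate i = u.castSucc ∨ X.mate i = u.succ then X.mate (X.mate i) else X.mate i)) ∧
    p u.castSucc = p u.succ ∧
    p (if u.castSucc = u.castSucc ∨ u.castSucc = u.succ then X.mate u.castSucc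
      else u.castSucc) =
      p (if u.succ = u.castSucc ∨ u.succ = u.succ then X.mate u.succ else u.succ) := by
  have h0 := hp 0
  have h1 := hp 1
  have h2 := hp 2
  have h3 := hp 3
  clear hp
  refine ⟨fun i => ?_, ?_, ?_⟩
  · cases X <;> fin_cases u <;> fin_cases i <;> simp_all [PlatClosing.mate, innerClosing]
  · cases X <;> fin_cases u <;> simp_all [PlatClosing.mate, innerClosing]
  · cases X <;> fin_cases u <;> simp_all [PlatClosing.mate, innerClosing]

/-- The right arc and the closing form a single path between the two bypassing strands, so no circle
splits off. -/
theorem loops_of_isVertical_of_ne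
    (h : (s (Fin.last m)).IsVertical (f (Fin.last m)).overstrand)
    (hX : X ≠ innerClosing (f (Fin.last m)).upper) :
    loops ⟨m + 1, f, X⟩ s =
      loops ⟨m, f ∘ Fin.castSucc, innerClosing (f (Fin.last m)).upper⟩ (s ∘ Fin.castSucc) := by
  refine Nat.card_congr (quotEquivOfRight
    (fun i => if i = (f (Fin.last m)).top ∨ i = (f (Fin.last m)).bot then X.mate i else i)
    (fun i => ?_) (mk_innerClosing h) ?_)
  · split_ifs with hi
    · rw [mk_right_mate, mk_away] <;>
      · revert hi hX
        dsimp only [PlatCrossing.top, PlatCrossing.bot]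
        generalize (f (Fin.last m)).upper = u
        cases X <;> revert u i <;> decide
    · push Not at hi
      exact (mk_away i hi.1 hi.2).symm
  · intro x y hxy
    have hY (i : Fin 4) : Quot.mk (Joined ⟨m, f ∘ Fin.castSucc,
        innerClosing (f (Fin.last m)).upper⟩ (s ∘ Fin.castSucc)) (Fin.last m, i) =
        Quot.mk _ (Fin.last m, (innerClosing (f (Fin.last m)).upper).mate i) :=
      Quot.sound (.rightEnd (D := ⟨m, f ∘ Fin.castSucc, _⟩) i)
    refine Joined.lift_succ (Y := innerClosing (f (Fin.last m)).upper) (Quot.mk _)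
      (fun i => Quot.mk _ (Fin.last m,
        if i = (f (Fin.last m)).top ∨ i = (f (Fin.last m)).bot then X.mate i else i))
      (fun _ _ h => Quot.sound h) ?_ ?_ (fun h' => absurd h h') (fun _ => ?_) hxy
    · exact (reroute_eq hX _ hY).1
    · intro i ht hb
      simp [ht, hb]
    · exact (reroute_eq hX _ hY).2

instance (D : FourPlat) (s : Fin D.size → Smoothing) : Finite (Quot (D.Joined s)) :=
  Finite.of_surjective _ Quot.mk_surjective

/-- The closing joins the two right ends of the crossing to each other, so with the right arc they
form a separate circle. -/
theorem loops_of_isVertical_of_eq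
    (h : (s (Fin.last m)).IsVertical (f (Fin.last m)).overstrand)
    (hX : X = innerClosing (f (Fin.last m)).upper) :
    loops ⟨m + 1, f, X⟩ s = loops ⟨m, f ∘ Fin.castSucc, X⟩ (s ∘ Fin.castSucc) + 1 := by
  rw [hX]
  have hmate (u : Fin 3) (i : Fin 4) :
      ((innerClosing u).mate i = u.castSucc ∨ (innerClosing u).mate i = u.succ) ↔
        (i = u.castSucc ∨ i = u.succ) := by
    revert u i; decide
  have htop (u : Fin 3) : (innerClosing u).mate u.castSucc = u.succ := by
    revert u; decide
  refine (Nat.card_congr (quotEquivOption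
    (fun i => decide (i = (f (Fin.last m)).top ∨ i = (f (Fin.last m)).bot))
    (f (Fin.last m)).top (by simp) (fun i hi => ?_) (fun i hi => ?_)
    (mk_innerClosing h) ?_)).trans (Finite.card_option ..)
  · simp only [decide_eq_true_eq] at hi
    obtain rfl | rfl := hi
    · rfl
    · exact (Quot.sound (.verticalRight (D := ⟨m + 1, f, _⟩) (Fin.last m) h)).symm
  · simp only [decide_eq_false_iff_not, not_or] at hi
    exact (mk_away i hi.1 hi.2).symm
  · intro x y hxy
    have hY (i : Fin 4) : Quot.mk (Joined ⟨m, f ∘ Fin.castSucc,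
        innerClosing (f (Fin.last m)).upper⟩ (s ∘ Fin.castSucc)) (Fin.last m, i) =
        Quot.mk _ (Fin.last m, (innerClosing (f (Fin.last m)).upper).mate i) :=
      Quot.sound (.rightEnd (D := ⟨m, f ∘ Fin.castSucc, _⟩) i)
    refine Joined.lift_succ (Y := innerClosing (f (Fin.last m)).upper)
      (fun a => some (Quot.mk _ a))
      (fun i => if decide (i = (f (Fin.last m)).top ∨ i = (f (Fin.last m)).bot) then none
        else some (Quot.mk _ (Fin.last m, i)))
      (fun _ _ h => congrArg some (Quot.sound h)) (fun i => ?_) (fun i ht hb => ?_)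
      (fun h' => absurd h h') (fun _ => ⟨?_, ?_⟩) hxy
    · simp only [PlatCrossing.top, PlatCrossing.bot, hmate]
      exact if_congr Iff.rfl rfl (congrArg some (hY i))
    · simp [ht, hb]
    · rw [hY]
      simp only [PlatCrossing.top, PlatCrossing.bot, htop]
    · simp

theorem loops_pos (D : FourPlat) (s : Fin D.size → Smoothing) : 0 < D.loops s :=
  have : Nonempty (Quot (D.Joined s)) := ⟨Quot.mk _ (0, 0)⟩
  Nat.card_pos

theorem loops_zero_adjacent (f : Fin 0 → PlatCrossing) (s : Fin 0 → Smoothing) :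
    loops ⟨0, f, .adjacent⟩ s = 2 := by
  let e : Quot (Joined ⟨0, f, .adjacent⟩ s) ≃ Bool :=
    { toFun := Quot.lift (fun x : Fin 1 × Fin 4 => decide (x.2 ≤ 1)) (by
        intro a b h
        cases h with
        | leftEnd i => fin_cases i <;> rfl
        | rightEnd i => fin_cases i <;> rfl
        | away j => exact j.elim0
        | horizontal j => exact j.elim0
        | verticalLeft j => exact j.elim0
        | verticalRight j => exact j.elim0)
      invFun := fun b => Quot.mk _ (0, if b then 0 else 2)
      left_inv := by
        rintro ⟨j, i⟩
        have h (i) := Quot.sound (Joined.leftEnd (D := ⟨0, f, .adjacent⟩) (s := s) i)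
        obtain rfl : j = 0 := Subsingleton.elim (α := Fin 1) _ _
        fin_cases i
        · rfl
        · exact h 0
        · rfl
        · exact h 2
      right_inv := by rintro (_ | _) <;> rfl }
  exact (Nat.card_congr e).trans (by simp)

theorem loops_zero_nested (f : Fin 0 → PlatCrossing) (s : Fin 0 → Smoothing) :
    loops ⟨0, f, .nested⟩ s = 1 := by
  have h (i) := Quot.sound (Joined.leftEnd (D := ⟨0, f, .nested⟩) (s := s) i)
  have h' (i) := Quot.sound (Joined.rightEnd (D := ⟨0, f, .nested⟩) (s := s) i)
  have key : ∀ x : Quot (Joined ⟨0, f, .nested⟩ s), x = Quot.mk _ (0, 0) := by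
    rintro ⟨j, i⟩
    obtain rfl : j = 0 := Subsingleton.elim (α := Fin 1) _ _
    fin_cases i
    · rfl
    · exact (h 0).symm
    · exact (h' 1).symm.trans (h 0).symm
    · exact (h' 0).symm
  have : Unique (Quot (Joined ⟨0, f, .nested⟩ s)) := ⟨⟨Quot.mk _ (0, 0)⟩, key⟩
  exact Nat.card_unique

end Loops

/-! ### The bracket as a product of transfer matrices -/

/-- The action of a vertically smoothed crossing on the pair of brackets with the two right
closings. -/
def cupCap (u : Fin 3) (v : PlatClosing → ℂ[T;T⁻¹]) (X : PlatClosing) : ℂ[T;T⁻¹] :=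
  (if X = innerClosing u then loopValue else 1) * v (innerClosing u)

/-- The Kauffman bracket in terms of the diagrams obtained by smoothing the last crossing. -/
theorem bracket_succ {m : ℕ} (f : Fin (m + 1) → PlatCrossing) (X : PlatClosing) :
    bracket ⟨m + 1, f, X⟩ =
      match (f (Fin.last m)).overstrand with
      | .rising =>
        (kauffmanA : ℂ[T;T⁻¹]) *
            cupCap (f (Fin.last m)).upper (fun Y => bracket ⟨m, f ∘ Fin.castSucc, Y⟩) X +
          ((kauffmanA⁻¹ : (ℂ[T;T⁻¹])ˣ) : ℂ[T;T⁻¹]) * bracket ⟨m, f ∘ Fin.castSucc, X⟩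
      | .falling =>
        (kauffmanA : ℂ[T;T⁻¹]) * bracket ⟨m, f ∘ Fin.castSucc, X⟩ +
          ((kauffmanA⁻¹ : (ℂ[T;T⁻¹])ˣ) : ℂ[T;T⁻¹]) *
            cupCap (f (Fin.last m)).upper (fun Y => bracket ⟨m, f ∘ Fin.castSucc, Y⟩) X := by
  have hsum (F : (Fin (m + 1) → Smoothing) → ℂ[T;T⁻¹]) :
      ∑ s, F s = ∑ s : Fin m → Smoothing,
        (F (Fin.snoc (α := fun _ => Smoothing) s .A) +
          F (Fin.snoc (α := fun _ => Smoothing) s .B)) := by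
    rw [← (Fin.snocEquiv (fun _ => Smoothing)).sum_comp, Fintype.sum_prod_type_right]
    refine Finset.sum_congr rfl fun s _ => ?_
    exact Finset.sum_pair (by decide)
  have hhor (s : Fin m → Smoothing) (x : Smoothing)
      (h : ¬ x.IsVertical (f (Fin.last m)).overstrand) :
      loops ⟨m + 1, f, X⟩ (Fin.snoc (α := fun _ => Smoothing) s x) =
        loops ⟨m, f ∘ Fin.castSucc, X⟩ s := by
    rw [loops_of_not_isVertical (by simpa using h)]
    congr 1
    ext j
    simp
  have hver (s : Fin m → Smoothing) (x : Smoothing)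
      (h : x.IsVertical (f (Fin.last m)).overstrand) :
      loopValue ^ (loops ⟨m + 1, f, X⟩ (Fin.snoc (α := fun _ => Smoothing) s x) - 1) =
        (if X = innerClosing (f (Fin.last m)).upper then loopValue else 1) * loopValue ^
          (loops ⟨m, f ∘ Fin.castSucc, innerClosing (f (Fin.last m)).upper⟩ s - 1) := by
    have hs : (Fin.snoc (α := fun _ => Smoothing) s x : Fin (m + 1) → Smoothing) ∘
        Fin.castSucc = s := by
      ext j
      simp
    split_ifs with hX
    · rw [loops_of_isVertical_of_eq (by simpa using h) hX, hs, hX, ← pow_succ']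
      -- Positivity is needed because the exponent is a truncated subtraction.
      have := loops_pos ⟨m, f ∘ Fin.castSucc, innerClosing (f (Fin.last m)).upper⟩ s
      congr 1
      omega
    · rw [loops_of_isVertical_of_ne (by simpa using h) hX, hs, one_mul]
  unfold bracket cupCap
  rw [hsum]
  cases ho : (f (Fin.last m)).overstrand
  · simp only [Finset.mul_sum, ← Finset.sum_add_distrib]
    refine Finset.sum_congr rfl fun s _ => ?_
    rw [hver s .A (by rw [ho]; rfl), hhor s .B (by rw [ho]; nofun)]
    simp only [Fin.prod_univ_castSucc, Fin.snoc_castSucc, Fin.snoc_last, Smoothing.weight,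
      Units.val_mul]
    ring
  · simp only [Finset.mul_sum, ← Finset.sum_add_distrib]
    refine Finset.sum_congr rfl fun s _ => ?_
    rw [hhor s .A (by rw [ho]; nofun), hver s .B (by rw [ho]; rfl)]
    simp only [Fin.prod_univ_castSucc, Fin.snoc_castSucc, Fin.snoc_last, Smoothing.weight,
      Units.val_mul]
    ring

end FourPlat

namespace FourPlat

/-- The action of a crossing on the pair of brackets with the two right closings. -/
def transfer (v : PlatClosing → ℂ[T;T⁻¹]) (c : PlatCrossing) (X : PlatClosing) : ℂ[T;T⁻¹] :=
  match c.overstrand with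
  | .rising => (kauffmanA : ℂ[T;T⁻¹]) * cupCap c.upper v X +
      ((kauffmanA⁻¹ : (ℂ[T;T⁻¹])ˣ) : ℂ[T;T⁻¹]) * v X
  | .falling => (kauffmanA : ℂ[T;T⁻¹]) * v X +
      ((kauffmanA⁻¹ : (ℂ[T;T⁻¹])ˣ) : ℂ[T;T⁻¹]) * cupCap c.upper v X

/-- The brackets of the two diagrams without crossings. -/
def emptyBracket : PlatClosing → ℂ[T;T⁻¹]
  | .adjacent => loopValue
  | .nested => 1

theorem bracket_eq_foldl {m : ℕ} (f : Fin m → PlatCrossing) :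
    (fun X => bracket ⟨m, f, X⟩) = (List.ofFn f).foldl transfer emptyBracket := by
  induction m with
  | zero =>
    ext1 X
    cases X
    · simp [bracket, emptyBracket, loops_zero_adjacent]
    · simp [bracket, emptyBracket, loops_zero_nested]
  | succ m ih =>
    rw [List.ofFn_succ', List.concat_eq_append, List.foldl_append]
    have := ih (f ∘ Fin.castSucc)
    simp only [Function.comp_def] at this
    rw [← this]
    ext1 X
    exact bracket_succ f X

/-! ### Twist boxes -/

/-- This is the Temperley–Lieb relation: the second application meets its own closing and produces a
circle. -/
theorem cupCap_cupCap (u : Fin 3) (v : PlatClosing → ℂ[T;T⁻¹]) (X : PlatClosing) :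
    cupCap u (cupCap u v) X = loopValue * cupCap u v X := by
  simp only [cupCap, if_true]
  ring

theorem cupCap_const_mul (u : Fin 3) (r : ℂ[T;T⁻¹]) (v : PlatClosing → ℂ[T;T⁻¹])
    (X : PlatClosing) : cupCap u (fun Y => r * v Y) X = r * cupCap u v X := by
  simp only [cupCap]
  ring

theorem cupCap_add (u : Fin 3) (v w : PlatClosing → ℂ[T;T⁻¹]) (X : PlatClosing) :
    cupCap u (fun Y => v Y + w Y) X = cupCap u v X + cupCap u w X := by
  simp only [cupCap]
  ring

/-- The brackets after a row of equal crossings, if those after one crossing, rescaled by `κ`,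
are given by the eigenvalues `U` and `U⁻¹`. -/
theorem foldl_replicate_transfer (κ U : (ℂ[T;T⁻¹])ˣ) (e : ℂ[T;T⁻¹]) (c : PlatCrossing)
    (he : e * loopValue = U - (U⁻¹ : (ℂ[T;T⁻¹])ˣ))
    (hc : ∀ v X, κ * transfer v c X =
      e * cupCap c.upper v X + ((U⁻¹ : (ℂ[T;T⁻¹])ˣ) : ℂ[T;T⁻¹]) * v X)
    (v : PlatClosing → ℂ[T;T⁻¹]) (N : ℕ) (X : PlatClosing) :
    loopValue * ((κ ^ N : (ℂ[T;T⁻¹])ˣ) * (List.replicate N c).foldl transfer v X) =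
      ((U⁻¹ ^ N : (ℂ[T;T⁻¹])ˣ) : ℂ[T;T⁻¹]) * loopValue * v X +
        (((U ^ N : (ℂ[T;T⁻¹])ˣ) : ℂ[T;T⁻¹]) - (U⁻¹ ^ N : (ℂ[T;T⁻¹])ˣ)) * cupCap c.upper v X := by
  induction N generalizing X with
  | zero => simp
  | succ N ih =>
    rw [List.replicate_succ', List.foldl_append, List.foldl_cons, List.foldl_nil]
    set w := (List.replicate N c).foldl transfer v with hw
    -- Applying `cupCap` to the induction hypothesis shows that on its image the row acts by `U ^
    -- N`.
    have hE : loopValue * ((κ ^ N : (ℂ[T;T⁻¹])ˣ) * cupCap c.upper w X) =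
        ((U ^ N : (ℂ[T;T⁻¹])ˣ) : ℂ[T;T⁻¹]) * loopValue * cupCap c.upper v X := by
      have h := congrArg (fun z => cupCap c.upper z X) (funext ih)
      simp only [cupCap_add, cupCap_const_mul, cupCap_cupCap,
        mul_assoc (((U⁻¹ ^ N : (ℂ[T;T⁻¹])ˣ) : ℂ[T;T⁻¹]))] at h
      rw [h]
      ring
    have hcw := hc w X
    have ihX := ih X
    simp only [pow_succ, Units.val_mul] at *
    have hU : ((U⁻¹ : (ℂ[T;T⁻¹])ˣ) : ℂ[T;T⁻¹]) * U = 1 := by simp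
    linear_combination loopValue * ((κ ^ N : (ℂ[T;T⁻¹])ˣ) : ℂ[T;T⁻¹]) * hcw + e * hE +
      ((U⁻¹ : (ℂ[T;T⁻¹])ˣ) : ℂ[T;T⁻¹]) * ihX +
      ((U ^ N : (ℂ[T;T⁻¹])ˣ) : ℂ[T;T⁻¹]) * cupCap c.upper v X * he

end FourPlat

/-! ### The rescaling factor and the variable u -/

/-- The factor `u (-A)⁻³` by which the definition of the Lawrence–Rosenstein polynomial rescales
the bracket for each crossing. -/
def lrScale : (ℂ[T;T⁻¹])ˣ := lrU * ((-kauffmanA) ^ (3 : ℤ))⁻¹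

theorem coe_kauffmanA : (kauffmanA : ℂ[T;T⁻¹]) = LaurentPolynomial.T 1 := rfl

theorem coe_kauffmanA_inv :
    ((kauffmanA⁻¹ : (ℂ[T;T⁻¹])ˣ) : ℂ[T;T⁻¹]) = LaurentPolynomial.T (-1) := rfl

theorem coe_lrU : (lrU : ℂ[T;T⁻¹]) = LaurentPolynomial.C Complex.I * LaurentPolynomial.T 2 := by
  simp [lrU, coe_kauffmanA, LaurentPolynomial.T_pow]

theorem C_I_sq :
    (LaurentPolynomial.C Complex.I : ℂ[T;T⁻¹]) * LaurentPolynomial.C Complex.I = -1 := by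
  rw [← map_mul, Complex.I_mul_I, map_neg, map_one]

theorem coe_lrU_inv : ((lrU⁻¹ : (ℂ[T;T⁻¹])ˣ) : ℂ[T;T⁻¹]) =
    -(LaurentPolynomial.C Complex.I * LaurentPolynomial.T (-2)) := by
  rw [Units.inv_eq_of_mul_eq_one_right]
  have h : (LaurentPolynomial.T 2 : ℂ[T;T⁻¹]) * LaurentPolynomial.T (-2) = 1 := by
    rw [← LaurentPolynomial.T_add]; simp
  rw [coe_lrU]
  linear_combination -(LaurentPolynomial.C Complex.I * LaurentPolynomial.C Complex.I) * h - C_I_sq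

theorem loopValue_eq :
    loopValue = -LaurentPolynomial.T 2 - LaurentPolynomial.T (-2) := by
  have h : ((kauffmanA ^ (-2 : ℤ) : (ℂ[T;T⁻¹])ˣ) : ℂ[T;T⁻¹]) = LaurentPolynomial.T (-2) := by
    rw [zpow_neg, ← inv_zpow]
    simp [zpow_ofNat, coe_kauffmanA_inv, LaurentPolynomial.T_pow]
  rw [loopValue, h]
  simp [coe_kauffmanA, LaurentPolynomial.T_pow]

/-- This is the relation making the two eigenvalues of a rescaled crossing inverse to each other. -/
theorem I_mul_loopValue :
    LaurentPolynomial.C Complex.I * loopValue = ((lrU⁻¹ : (ℂ[T;T⁻¹])ˣ) : ℂ[T;T⁻¹]) - lrU := by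
  rw [loopValue_eq, coe_lrU, coe_lrU_inv]
  ring

theorem coe_lrScale_mul : (lrScale : ℂ[T;T⁻¹]) * kauffmanA = -LaurentPolynomial.C Complex.I := by
  have h : lrScale * kauffmanA * kauffmanA ^ 2 = -lrU := by
    have : lrScale * (-kauffmanA) ^ (3 : ℤ) = lrU := by simp [lrScale]
    rw [← this, zpow_ofNat, Odd.neg_pow (by decide), mul_neg, neg_neg, pow_succ' _ 2, mul_assoc]
  rw [← Units.mul_left_inj (kauffmanA ^ 2), ← Units.val_mul, ← Units.val_mul, h]
  simp [coe_lrU, coe_kauffmanA, LaurentPolynomial.T_pow]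

theorem coe_lrScale : (lrScale : ℂ[T;T⁻¹]) =
    -(LaurentPolynomial.C Complex.I * LaurentPolynomial.T (-1)) := by
  rw [← Units.mul_left_inj kauffmanA, coe_lrScale_mul, coe_kauffmanA, neg_mul, mul_assoc,
    ← LaurentPolynomial.T_add]
  simp

theorem coe_lrScale_inv : ((lrScale⁻¹ : (ℂ[T;T⁻¹])ˣ) : ℂ[T;T⁻¹]) =
    LaurentPolynomial.C Complex.I * LaurentPolynomial.T 1 := by
  rw [Units.inv_eq_of_mul_eq_one_right]
  have h : (LaurentPolynomial.T (-1) : ℂ[T;T⁻¹]) * LaurentPolynomial.T 1 = 1 := by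
    rw [← LaurentPolynomial.T_add]; simp
  rw [coe_lrScale]
  linear_combination -(LaurentPolynomial.C Complex.I * LaurentPolynomial.C Complex.I) * h - C_I_sq

namespace FourPlat

/-- The effect of a whole twist box on the rescaled brackets. -/
theorem loopValue_mul_foldl_twist (m : ℤ) (c : PlatCrossing)
    (hc : c.overstrand = if 0 < m then .rising else .falling) (v : PlatClosing → ℂ[T;T⁻¹])
    (X : PlatClosing) :
    loopValue * ((lrScale ^ m : (ℂ[T;T⁻¹])ˣ) *
        (List.replicate m.natAbs c).foldl transfer v X) =
      lrPow (-m) * loopValue * v X + (lrPow m - lrPow (-m)) * cupCap c.upper v X := by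
  have hT : (LaurentPolynomial.T (-1) : ℂ[T;T⁻¹]) * LaurentPolynomial.T 1 = 1 := by
    rw [← LaurentPolynomial.T_add]; simp
  have hT2 : (LaurentPolynomial.T 1 : ℂ[T;T⁻¹]) * LaurentPolynomial.T 1 =
      LaurentPolynomial.T 2 := by
    rw [← LaurentPolynomial.T_add]; norm_num
  have hT2' : (LaurentPolynomial.T (-1) : ℂ[T;T⁻¹]) * LaurentPolynomial.T (-1) =
      LaurentPolynomial.T (-2) := by
    rw [← LaurentPolynomial.T_add]; norm_num
  split_ifs at hc with hm
  -- Rising crossings: κA = -i and κA⁻¹ = u⁻¹.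
  · obtain ⟨N, rfl⟩ := Int.eq_ofNat_of_zero_le hm.le
    have := foldl_replicate_transfer lrScale lrU (-LaurentPolynomial.C Complex.I) c
      (by rw [neg_mul, I_mul_loopValue]; ring)
      (fun w Y => by
        simp only [transfer, hc, coe_lrScale, coe_kauffmanA, coe_kauffmanA_inv, coe_lrU_inv,
          ← hT2']
        linear_combination -LaurentPolynomial.C Complex.I * cupCap c.upper w Y * hT)
      v N X
    simpa [lrPow, zpow_neg] using this
  -- Falling crossings: κ⁻¹A⁻¹ = i and κ⁻¹A = u, so u⁻¹ takes the role of u. An empty box falls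
  -- under this case.
  · obtain ⟨N, hN⟩ := Int.eq_ofNat_of_zero_le (neg_nonneg.2 (not_lt.1 hm))
    obtain rfl : m = -N := by omega
    have := foldl_replicate_transfer lrScale⁻¹ lrU⁻¹ (LaurentPolynomial.C Complex.I) c
      (by rw [inv_inv, I_mul_loopValue])
      (fun w Y => by
        simp only [transfer, hc, coe_lrScale_inv, coe_kauffmanA, coe_kauffmanA_inv, inv_inv,
          coe_lrU, ← hT2]
        linear_combination LaurentPolynomial.C Complex.I * cupCap c.upper w Y * hT)
      v N X
    simpa [lrPow, zpow_neg] using this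

end FourPlat

/-! ### Recursion over the twist boxes -/

theorem twistNumber_natAbs {n : ℕ} (a : Fin n → ℤ) (k : Fin n) :
    (twistNumber a k).natAbs = (a k).natAbs := by
  simp [twistNumber, Int.natAbs_mul, Int.natAbs_pow]

theorem rationalWord_succ {n : ℕ} (a : Fin (n + 1) → ℤ) :
    rationalWord a = rationalWord (a ∘ Fin.castSucc) ++
      List.replicate (twistNumber a (Fin.last n)).natAbs (twistCrossing a (Fin.last n)) := by
  rw [twistNumber_natAbs, rationalWord, List.ofFn_succ', List.concat_eq_append,
    List.flatten_append]
  simp only [List.flatten_cons, List.flatten_nil, List.append_nil]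
  rfl

/-- The rescaled brackets of the diagrams with twist boxes `a` and the two right closings. -/
def scaledBracket {n : ℕ} (a : Fin n → ℤ) (X : PlatClosing) : ℂ[T;T⁻¹] :=
  loopValue ^ n * ((lrScale ^ (∑ k, twistNumber a k) : (ℂ[T;T⁻¹])ˣ) *
    (rationalWord a).foldl FourPlat.transfer FourPlat.emptyBracket X)

theorem scaledBracket_succ {n : ℕ} (a : Fin (n + 1) → ℤ) (X : PlatClosing) :
    scaledBracket a X =
      lrPow (-twistNumber a (Fin.last n)) * loopValue * scaledBracket (a ∘ Fin.castSucc) X +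
        (lrPow (twistNumber a (Fin.last n)) - lrPow (-twistNumber a (Fin.last n))) *
          FourPlat.cupCap (if Even n then 1 else 0) (scaledBracket (a ∘ Fin.castSucc)) X := by
  have h := FourPlat.loopValue_mul_foldl_twist (twistNumber a (Fin.last n))
    (twistCrossing a (Fin.last n)) rfl
    ((rationalWord (a ∘ Fin.castSucc)).foldl FourPlat.transfer FourPlat.emptyBracket) X
  have hE : FourPlat.cupCap (if Even n then 1 else 0) (scaledBracket (a ∘ Fin.castSucc)) X = _ :=
    FourPlat.cupCap_const_mul _
      (loopValue ^ n * (lrScale ^ (∑ k, twistNumber (a ∘ Fin.castSucc) k) : (ℂ[T;T⁻¹])ˣ))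
      ((rationalWord (a ∘ Fin.castSucc)).foldl FourPlat.transfer FourPlat.emptyBracket) X
      |>.symm.trans (by simp only [mul_assoc]; rfl) |>.symm
  have hu : (twistCrossing a (Fin.last n)).upper = if Even n then 1 else 0 := rfl
  have hs : ∑ k : Fin n, twistNumber a k.castSucc = ∑ k, twistNumber (a ∘ Fin.castSucc) k := rfl
  rw [hu] at h
  simp only [scaledBracket, rationalWord_succ, List.foldl_append, Fin.sum_univ_castSucc, zpow_add,
    Units.val_mul, pow_succ, hs]
  rw [hE]
  linear_combination loopValue ^ n *
    ((lrScale ^ (∑ k, twistNumber (a ∘ Fin.castSucc) k) : (ℂ[T;T⁻¹])ˣ) : ℂ[T;T⁻¹]) * h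

/-- The right closing of the standard diagram with `n` twist boxes. -/
def rationalClosing (n : ℕ) : PlatClosing := if Even n then .nested else .adjacent

/-- The strands of the last box have inner closing `rationalClosing n`. Thus `cupCap` brings the
factor 1 for the standard closing and d for the other one, where the terms with u⁻ᵐ cancel. -/
theorem scaledBracket_rationalClosing {n : ℕ} (a : Fin (n + 1) → ℤ) :
    scaledBracket a (rationalClosing (n + 1)) =
        (lrPow (twistNumber a (Fin.last n)) - lrPow (-twistNumber a (Fin.last n))) *
          scaledBracket (a ∘ Fin.castSucc) (rationalClosing n) +
        lrPow (-twistNumber a (Fin.last n)) * loopValue *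
          scaledBracket (a ∘ Fin.castSucc) (rationalClosing (n + 1)) ∧
      scaledBracket a (rationalClosing (n + 2)) =
        lrPow (twistNumber a (Fin.last n)) * loopValue *
          scaledBracket (a ∘ Fin.castSucc) (rationalClosing n) := by
  rw [scaledBracket_succ, scaledBracket_succ]
  by_cases hn : Even n
  · simp [rationalClosing, FourPlat.cupCap, FourPlat.innerClosing, hn, Nat.even_add_one]
    constructor <;> ring
  · simp [rationalClosing, FourPlat.cupCap, FourPlat.innerClosing, hn, Nat.even_add_one]
    constructor <;> ring

theorem lawrenceRosenstein_eq_scaledBracket {n : ℕ} (a : Fin n → ℤ)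
    (o : (rationalDiagram a).Orientation) :
    lawrenceRosenstein a o = scaledBracket a (rationalClosing n) := by
  have hb : (rationalDiagram a).bracket =
      (rationalWord a).foldl FourPlat.transfer FourPlat.emptyBracket (rationalClosing n) := by
    have := congrFun (FourPlat.bracket_eq_foldl (rationalWord a).get) (rationalClosing n)
    rwa [List.ofFn_get] at this
  have hA : -kauffmanA ^ (-3 : ℤ) = (-kauffmanA) ^ (-3 : ℤ) := by
    rw [zpow_neg, zpow_neg, zpow_ofNat, zpow_ofNat, Odd.neg_pow (by decide), inv_neg]
  rw [lawrenceRosenstein, FourPlat.jones, hb, scaledBracket, hA, lrPow, lrScale]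
  set w := (rationalDiagram a).writhe o
  set M := ∑ k, twistNumber a k
  -- The writhe drops out because the exponents satisfy -3M = -3w - (-3w + 3M).
  have hu : (lrU * ((-kauffmanA) ^ (3 : ℤ))⁻¹) ^ M =
      lrU ^ M * (((-kauffmanA) ^ (-3 : ℤ)) ^ w * ((-kauffmanA) ^ (-3 * w + 3 * M))⁻¹) := by
    rw [mul_zpow, ← zpow_neg, ← zpow_neg, ← zpow_mul, ← zpow_mul, ← zpow_add]
    congr 2
    ring
  rw [hu]
  simp only [Units.val_mul]
  ring

theorem prod_lrMatrix_mul {n : ℕ} (a : Fin n → ℤ) :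
    (List.ofFn fun k => lrMatrix (twistNumber a k)).reverse.prod * !![1; loopValue] =
      !![scaledBracket a (rationalClosing n); scaledBracket a (rationalClosing (n + 1))] := by
  induction n with
  | zero =>
    ext i j
    fin_cases i <;> fin_cases j <;>
      simp [scaledBracket, rationalWord, rationalClosing, FourPlat.emptyBracket]
  | succ n ih =>
    rw [List.ofFn_succ', List.concat_eq_append, List.reverse_append, List.reverse_singleton,
      List.singleton_append, List.prod_cons, Matrix.mul_assoc]
    have := ih (a ∘ Fin.castSucc)
    simp only [twistNumber, Function.comp_apply] at this
    simp only [twistNumber, Fin.val_castSucc]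
    rw [this, (scaledBracket_rationalClosing a).1, (scaledBracket_rationalClosing a).2]
    ext i j
    fin_cases i <;> fin_cases j <;>
      simp [lrMatrix, twistNumber, Matrix.mul_apply, Fin.sum_univ_two]

/-! ### Subsets and their intervals -/

/-- The first elements of the intervals of `S`. -/
def intervalStarts {n : ℕ} (S : Finset (Fin n)) : Finset (Fin n) :=
  {k ∈ S | ∀ j ∈ S, (j : ℕ) + 1 ≠ k}

/-- A maximal interval is determined by its first element, and first elements are easy to track when
an index is appended. -/
theorem ncard_maxIntervals {n : ℕ} (S : Finset (Fin n)) :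
    (maxIntervals S).ncard = (intervalStarts S).card := by
  classical
  -- `I k` is the longest interval in `S` starting at `k`, when `k ∈ S`.
  let I (k : Fin n) : Finset (Fin n) := {j | k ≤ j ∧ Finset.Icc k j ⊆ S}
  have mem_I {k j : Fin n} : j ∈ I k ↔ k ≤ j ∧ Finset.Icc k j ⊆ S := by simp [I]
  have self_mem {k : Fin n} (hk : k ∈ S) : k ∈ I k := mem_I.2 ⟨le_rfl, by simpa using hk⟩
  have isInterval {k : Fin n} (hk : k ∈ S) :
      I k ⊆ S ∧ ∃ p q : Fin n, p ≤ q ∧ I k = Finset.Icc p q := by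
    refine ⟨fun j hj => (mem_I.1 hj).2 (Finset.right_mem_Icc.2 (mem_I.1 hj).1),
      k, (I k).max' ⟨k, self_mem hk⟩, Finset.le_max' _ _ (self_mem hk), ?_⟩
    ext j
    refine ⟨fun hj => Finset.mem_Icc.2 ⟨(mem_I.1 hj).1, Finset.le_max' _ _ hj⟩, fun hj => ?_⟩
    obtain ⟨h1, h2⟩ := Finset.mem_Icc.1 hj
    exact mem_I.2 ⟨h1, (Finset.Icc_subset_Icc_right h2).trans
      (mem_I.1 ((I k).max'_mem ⟨k, self_mem hk⟩)).2⟩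
  have himage : maxIntervals S = I '' (intervalStarts S : Set (Fin n)) := by
    ext J
    constructor
    · intro hJ
      rw [maxIntervals, Set.mem_ofPred_eq] at hJ
      obtain ⟨hJS, k, l, hkl, rfl⟩ := hJ.prop
      have hk : k ∈ S := hJS (Finset.left_mem_Icc.2 hkl)
      refine ⟨k, ?_, ?_⟩
      · simp only [intervalStarts, Finset.coe_filter, Set.mem_ofPred_eq]
        refine ⟨hk, fun j hj hjk => ?_⟩
        -- If the predecessor `j` of `k` were in `S`, the interval could be prolonged to the left.
        have hsub : Finset.Icc j l ⊆ S := by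
          intro i hi
          obtain ⟨h1, h2⟩ := Finset.mem_Icc.1 hi
          rcases eq_or_lt_of_le h1 with rfl | h1
          · exact hj
          · exact hJS (Finset.mem_Icc.2 ⟨by rw [Fin.le_def]; rw [Fin.lt_def] at h1; omega, h2⟩)
        have hjk' : j ≤ k := by rw [Fin.le_def]; omega
        have := hJ.le_of_ge ⟨hsub, j, l, hjk'.trans hkl, rfl⟩
          (Finset.Icc_subset_Icc_left hjk') (Finset.left_mem_Icc.2 (hjk'.trans hkl))
        have := Fin.le_def.1 (Finset.mem_Icc.1 this).1
        omega
      · refine (hJ.eq_of_le (isInterval hk) fun j hj => ?_).symm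
        obtain ⟨h1, h2⟩ := Finset.mem_Icc.1 hj
        exact mem_I.2 ⟨h1, (Finset.Icc_subset_Icc_right h2).trans hJS⟩
    · rintro ⟨k, hk, rfl⟩
      simp only [intervalStarts, Finset.coe_filter, Set.mem_ofPred_eq] at hk
      refine ⟨isInterval hk.1, ?_⟩
      rintro J ⟨hJS, p, q, hpq, rfl⟩ hle j hj
      obtain ⟨hpk, hkq⟩ := Finset.mem_Icc.1 (hle (self_mem hk.1))
      obtain rfl | hlt := eq_or_lt_of_le hpk
      · obtain ⟨h1, h2⟩ := Finset.mem_Icc.1 hj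
        exact mem_I.2 ⟨h1, (Finset.Icc_subset_Icc_right h2).trans hJS⟩
      · rw [Fin.lt_def] at hlt
        -- An interval starting before `k` would contain `k - 1`, contradicting that `k` is a start.
        refine absurd ?_ (hk.2 ⟨(k : ℕ) - 1, by omega⟩ (hJS (Finset.mem_Icc.2 ⟨?_, ?_⟩)))
        · simp only; omega
        · rw [Fin.le_def]; simp only; omega
        · rw [Fin.le_def] at *; simp only; omega
  rw [himage, Set.InjOn.ncard_image, Set.ncard_coe_finset]
  intro k hk l hl hkl
  have hk' : k ∈ S := (Finset.mem_filter.1 hk).1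
  have hl' : l ∈ S := (Finset.mem_filter.1 hl).1
  exact le_antisymm (mem_I.1 (hkl ▸ self_mem hl' : l ∈ I k)).1
    (mem_I.1 (hkl ▸ self_mem hk' : k ∈ I l)).1

theorem card_intervalStarts_map {n : ℕ} (S : Finset (Fin n)) :
    (intervalStarts (S.map Fin.castSuccEmb)).card = (intervalStarts S).card := by
  rw [← Finset.card_map Fin.castSuccEmb (s := intervalStarts S)]
  congr 1
  ext k
  induction k using Fin.lastCases <;> simp [intervalStarts]

/-- The new last index prolongs an interval if its predecessor lies in `S` and is a new start
otherwise; being last, it affects no other start. -/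
theorem card_intervalStarts_insert {n : ℕ} (S : Finset (Fin n)) :
    (intervalStarts (insert (Fin.last n) (S.map Fin.castSuccEmb))).card =
      (intervalStarts S).card + if ∀ j ∈ S, (j : ℕ) + 1 ≠ n then 1 else 0 := by
  have key (k : Fin n) : ¬ (n + 1 = (k : ℕ)) := by omega
  split_ifs with h
  · rw [← Finset.card_map Fin.castSuccEmb (s := intervalStarts S),
      ← Finset.card_insert_of_notMem (a := Fin.last n) (by simp)]
    congr 1
    ext k
    induction k using Fin.lastCases with
    | last => simpa [intervalStarts] using h
    | cast k => simp [intervalStarts, key]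
  · rw [add_zero, ← Finset.card_map Fin.castSuccEmb (s := intervalStarts S)]
    congr 1
    ext k
    induction k using Fin.lastCases with
    | last => simpa [intervalStarts] using h
    | cast k => simp [intervalStarts, key]

theorem Fin.sum_finset_succ {M : Type*} [AddCommMonoid M] {n : ℕ}
    (F : Finset (Fin (n + 1)) → M) :
    ∑ S, F S = ∑ S : Finset (Fin n),
      (F (S.map Fin.castSuccEmb) + F (insert (Fin.last n) (S.map Fin.castSuccEmb))) := by
  rw [← Finset.powerset_univ, Fin.univ_castSuccEmb, Finset.cons_eq_insert,
    Finset.sum_powerset_insert (by simp), Finset.sum_add_distrib]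
  have h (G : Finset (Fin (n + 1)) → M) :
      ∑ S ∈ (Finset.univ.map Fin.castSuccEmb).powerset, G S =
        ∑ S : Finset (Fin n), G (S.map Fin.castSuccEmb) := by
    rw [← Finset.powerset_univ]
    refine (Finset.sum_bij (fun S _ => S.map Fin.castSuccEmb) ?_ ?_ ?_ ?_).symm
    · intro S _
      exact Finset.mem_powerset.2 (Finset.map_subset_map.2 (Finset.subset_univ _))
    · intro S _ T _ h
      exact Finset.map_injective _ h
    · intro S hS
      obtain ⟨T, -, rfl⟩ := Finset.subset_map_iff.1 (Finset.mem_powerset.1 hS)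
      exact ⟨T, by simp, rfl⟩
    · intro S _
      rfl
  rw [h, h]

/-! ### Expansion over subsets -/

/-- The summand of a subset in the expansion of the Lawrence–Rosenstein polynomial. -/
def intervalTerm {n : ℕ} (m : Fin n → ℤ) (S : Finset (Fin n)) : ℂ[T;T⁻¹] :=
  (∏ k, if k ∈ S then -lrPow (-m k) else lrPow (m k)) *
    (1 - loopValue ^ 2) ^ (intervalStarts S).card

theorem intervalTerm_map {n : ℕ} (m : Fin (n + 1) → ℤ) (S : Finset (Fin n)) :
    intervalTerm m (S.map Fin.castSuccEmb) =
      lrPow (m (Fin.last n)) * intervalTerm (m ∘ Fin.castSucc) S := by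
  rw [intervalTerm, intervalTerm, card_intervalStarts_map, Fin.prod_univ_castSucc]
  simp
  ring

theorem intervalTerm_insert {n : ℕ} (m : Fin (n + 1) → ℤ) (S : Finset (Fin n)) :
    intervalTerm m (insert (Fin.last n) (S.map Fin.castSuccEmb)) =
      -lrPow (-m (Fin.last n)) * (intervalTerm (m ∘ Fin.castSucc) S - loopValue ^ 2 *
        if ∀ j ∈ S, (j : ℕ) + 1 ≠ n then intervalTerm (m ∘ Fin.castSucc) S else 0) := by
  rw [intervalTerm, intervalTerm, card_intervalStarts_insert, Fin.prod_univ_castSucc,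
    if_pos (Finset.mem_insert_self _ _)]
  split_ifs <;> simp <;> ring

/-- The second identity is carried along for the induction: the bracket with the other closing
accounts for the sets to which the next index adds a new interval. -/
theorem scaledBracket_eq_sum {n : ℕ} (a : Fin n → ℤ) :
    scaledBracket a (rationalClosing n) = ∑ S, intervalTerm (twistNumber a) S ∧
      scaledBracket a (rationalClosing (n + 1)) = loopValue *
        ∑ S : Finset (Fin n), if ∀ j ∈ S, (j : ℕ) + 1 ≠ n then
          intervalTerm (twistNumber a) S else 0 := by
  induction n with
  | zero =>
    simp [scaledBracket, rationalWord, rationalClosing, FourPlat.emptyBracket, intervalTerm,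
      Finset.eq_empty_of_isEmpty]
  | succ n ih =>
    obtain ⟨ih1, ih2⟩ := ih (a ∘ Fin.castSucc)
    have ha : twistNumber a ∘ Fin.castSucc = twistNumber (a ∘ Fin.castSucc) := rfl
    rw [(scaledBracket_rationalClosing a).1, (scaledBracket_rationalClosing a).2, ih1, ih2,
      Fin.sum_finset_succ, Fin.sum_finset_succ]
    simp only [intervalTerm_map, intervalTerm_insert, ha]
    constructor
    · simp only [Finset.sum_add_distrib, ← Finset.mul_sum, Finset.sum_sub_distrib]
      ring
    -- Exactly the sets without the new last index survive the condition.
    · have h1 (S : Finset (Fin n)) :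
          ∀ j ∈ S.map Fin.castSuccEmb, (j : ℕ) + 1 ≠ n + 1 := by
        simp only [Finset.mem_map]
        rintro _ ⟨k, -, rfl⟩
        simp only [Fin.castSuccEmb_apply, Fin.val_castSucc]
        omega
      have h2 (S : Finset (Fin n)) :
          ¬ ∀ j ∈ insert (Fin.last n) (S.map Fin.castSuccEmb), (j : ℕ) + 1 ≠ n + 1 :=
        fun h => h _ (Finset.mem_insert_self _ _) rfl
      simp only [if_pos (h1 _), if_neg (h2 _), add_zero, ← Finset.mul_sum]
      ring

/-- Squaring id = u⁻¹ - u gives -d² = u² + u⁻² - 2. -/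
theorem lrPow_two_add : lrPow 2 + lrPow (-2) - 1 = 1 - loopValue ^ 2 := by
  have h1 : lrPow 2 = lrU * lrU := by simp [lrPow, zpow_ofNat, sq]
  have h2 : lrPow (-2) = (lrU⁻¹ : (ℂ[T;T⁻¹])ˣ) * (lrU⁻¹ : (ℂ[T;T⁻¹])ˣ) := by
    rw [lrPow, zpow_neg, ← inv_zpow, zpow_ofNat, sq, Units.val_mul]
  have h3 : (lrU : ℂ[T;T⁻¹]) * (lrU⁻¹ : (ℂ[T;T⁻¹])ˣ) = 1 := by simp
  rw [h1, h2]
  linear_combination (LaurentPolynomial.C Complex.I * loopValue +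
    (lrU⁻¹ : (ℂ[T;T⁻¹])ˣ) - lrU) * (-I_mul_loopValue) + 2 * h3 + loopValue ^ 2 * C_I_sq

end

theorem theorem7p2 {n : ℕ} (a : Fin n → ℤ) (ha : ∀ k, a k ≠ 0)
    (o : (rationalDiagram a).Orientation) :
    lawrenceRosenstein a o =
        ((!![1, 0] : Matrix (Fin 1) (Fin 2) ℂ[T;T⁻¹]) * ((List.ofFn fun k => lrMatrix (twistNumber a k)).reverse.prod *
          !![1; loopValue])) 0 0 ∧
      lawrenceRosenstein a o =
        ∑ S : Finset (Fin n),
          (∏ k ∈ Sᶜ, lrPow (twistNumber a k)) * (∏ k ∈ S, -lrPow (-twistNumber a k)) *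
            (lrPow 2 + lrPow (-2) - 1) ^ (maxIntervals S).ncard := by
  rw [lawrenceRosenstein_eq_scaledBracket]
  constructor
  · rw [prod_lrMatrix_mul]
    simp [Matrix.mul_apply, Fin.sum_univ_two]
  · rw [(scaledBracket_eq_sum a).1]
    refine Finset.sum_congr rfl fun S _ => ?_
    rw [intervalTerm, ncard_maxIntervals, lrPow_two_add,
      ← Finset.prod_compl_mul_prod S (fun k => if k ∈ S then _ else _)]
    congr 2
    · exact Finset.prod_congr rfl fun k hk => if_neg (Finset.mem_compl.1 hk)
    · exact Finset.prod_congr rfl fun k hk => if_pos hk
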